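/- **Conventions.** Digraphs are directed multigraphs, with parallel edges and self loops allowed. A digraph is regular if for some $d\ge 1$ every vertex has in-degree $d$ and out-degree $d$. Its transition matrix is $W=AD^{-1}$, where $A_{ij}$ is the number of edges from $j$ to $i$ and $D$ is the diagonal matrix of out-degrees. For a real square matrix $A$, $A^+$ is its Moore–Penrose pseudo-inverse and $U_A=(A+A^\top)/2$. For symmetric matrices, $A\preceq B$ means that $B-A$ is positive semidefinite (PSD). For PSD $F$, put $\|x\|_F=\sqrt{x^\top Fx}$ and $\|A\|_F=\sup_{x\ne 0}\|Ax\|_F/\|x\|_F$, with $0/0=0$ and $a/0=\infty$ for $a>0$; so $\|A\|_F\le c$ means $\|Ax\|_F\le c\|x\|_F$ for all $x$. A matrix $\widetilde W$ is a unit-circle $\epsilon$-approximation of $W\in\mathbb C^{n\times n}$ if for all $x,y\in\mathbb C^n$ $$|x^*(W-\widetilde W)y|\le\frac{\epsilon}{2}\Big(\|x\|^2+\|y\|^2-|x^*Wx+y^*Wy|\Big).$$ The adjacency matrix of the directed $2^k$-cycle is ordered so that $C_1=[1]$ and $C_{2^{k}}=\begin{bmatrix}0&C_{2^{k-1}}\\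 I_{2^{k-1}}&0\end{bmatrix}$ for $k>0$. **Approximate LU factorization.** Let $k\ge 1$ be an integer and let $W_0,\dots,W_k\in\mathbb R^{n\times n}$. For $1\le j\le k$ let $X_j,Y_j$ be the $2^kn\times 2^kn$ matrices $$X_j=\begin{bmatrix}I_{(2^k-2^{k-j+1})n}&0&0\\0&I_{2^{k-j}n}&0\\0&-I_{2^{k-j}}\otimes W_{j-1}&I_{2^{k-j}n}\end{bmatrix},\qquad Y_j=\begin{bmatrix}I_{(2^k-2^{k-j+1})n}&0&0\\0&I_{2^{k-j}n}&-C_{2^{k-j}}\otimes W_{j-1}\\0&0&I_{2^{k-j}n}\end{bmatrix},$$ and for $0\le i\le k$ let $$L^{(i)}=X_1\cdots X_i\begin{bmatrix}I_{(2^k-2^{k-i})n}&0\\0&I_{2^{k-i}n}-C_{2^{k-i}}\otimes W_i\end{bmatrix}Y_i\cdots Y_1 .$$ **Theorem.** There is an absolute constant $C>0$ such that the following holds. Let $k\ge 1$ and $n$ be integers, let $\epsilon\in(0,1/2)$, and let $W=W_0,W_1,\dots,W_k$ be transition matrices of strongly connected regular digraphs on $n$ vertices such that, for every $0\le i<k$,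 $W_{i+1}$ is a unit-circle $(\epsilon/k)$-approximation of $W_i^2$. Let $L=I_{2^kn}-C_{2^k}\otimes W$ and $\widetilde L=L^{(k)}$. Then there is a real PSD matrix $F$ of size $2^kn\times 2^kn$ such that $$\|I_{2^kn}-\widetilde L^+L\|_F\le C\,k\,\epsilon\qquad\text{and}\qquad \frac{1}{C\,k}\,U_L\preceq F\preceq C\,2^{2k}n^2k^5\,U_L .$$ -/

import Mathlib

open scoped Matrix Kronecker

noncomputable section

namespace CycleLift

/-! ### Directed multigraphs and their transition matrices -/

/-- A directed multigraph (parallel edges and self loops allowed) on the vertex set `V`: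
`edges u v` is the number of edges from `u` to `v`. -/
structure Multidigraph (V : Type*) where
  edges : V → V → ℕ

namespace Multidigraph

variable {V : Type*}

/-- `G` is strongly connected: every vertex is reachable from every vertex along directed edges. -/
def StronglyConnected (G : Multidigraph V) : Prop :=
  ∀ u v : V, Relation.ReflTransGen (fun a b => 0 < G.edges a b) u v

variable [Fintype V]

def outDegree (G : Multidigraph V) (v : V) : ℕ := ∑ w, G.edges v w

def inDegree (G : Multidigraph V) (v : V) : ℕ := ∑ u, G.edges u v

/-- `G` is `d`-regular: every vertex has in-degree and out-degree `d`. -/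
def IsRegularOfDegree (G : Multidigraph V) (d : ℕ) : Prop :=
  ∀ v, G.outDegree v = d ∧ G.inDegree v = d

/-- The adjacency matrix; its `(i, j)` entry is the number of edges from `j` to `i`. -/
def adjMatrix (G : Multidigraph V) : Matrix V V ℝ := Matrix.of fun i j => (G.edges j i : ℝ)

variable [DecidableEq V]

/-- The diagonal matrix of out-degrees. -/
def degMatrix (G : Multidigraph V) : Matrix V V ℝ :=
  Matrix.diagonal fun v => (G.outDegree v : ℝ)

/-- The transition (random walk) matrix `A D⁻¹`. -/
def transitionMatrix (G : Multidigraph V) : Matrix V V ℝ := G.adjMatrix * G.degMatrix⁻¹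

end Multidigraph

/-- `W` is the transition matrix of a strongly connected regular digraph. The degree is positive,
so that the transition matrix is meaningful. -/
def IsStronglyConnectedRegularTransition {V : Type*} [Fintype V] [DecidableEq V]
    (W : Matrix V V ℝ) : Prop :=
  ∃ (G : Multidigraph V) (d : ℕ), 0 < d ∧ G.IsRegularOfDegree d ∧ G.StronglyConnected ∧
    W = G.transitionMatrix

/-! ### Unit-circle approximation -/

/-- `W'` is a unit-circle `ε`-approximation of `W`:
`|x* (W - W') y| ≤ (ε / 2) (‖x‖² + ‖y‖² - |x* W x + y* W y|)` for all complex vectors `x, y`. -/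
def UnitCircleApprox {V : Type*} [Fintype V] (ε : ℝ) (W' W : Matrix V V ℂ) : Prop :=
  ∀ x y : V → ℂ,
    ‖star x ⬝ᵥ ((W - W') *ᵥ y)‖ ≤
      ε / 2 * (∑ i, ‖x i‖ ^ 2 + ∑ i, ‖y i‖ ^ 2 -
        ‖star x ⬝ᵥ (W *ᵥ x) + star y ⬝ᵥ (W *ᵥ y)‖)

/-- A real matrix regarded as a complex matrix. -/
def toComplex {V : Type*} (W : Matrix V V ℝ) : Matrix V V ℂ := W.map (fun r : ℝ => (r : ℂ))

/-! ### Symmetrization, Loewner order, operator seminorm -/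

/-- The symmetrization `U_A = (A + Aᵀ) / 2` of a real matrix. -/
def symmetrization {ι : Type*} (A : Matrix ι ι ℝ) : Matrix ι ι ℝ := (1 / 2 : ℝ) • (A + Aᵀ)

/-- The Loewner order `A ⪯ B`: the matrix `B - A` is positive semidefinite. -/
def LoewnerLE {ι : Type*} (A B : Matrix ι ι ℝ) : Prop := (B - A).PosSemidef

/-- The seminorm `‖x‖_H = √(xᵀ H x)` of a vector, for a positive semidefinite `H`. -/
def vecSeminorm {ι : Type*} [Fintype ι] (H : Matrix ι ι ℝ) (x : ι → ℝ) : ℝ :=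
  √(x ⬝ᵥ (H *ᵥ x))

/-- The operator seminorm `‖A‖_H = sup_{x ≠ 0} ‖A x‖_H / ‖x‖_H`, with values in `[0, ∞]`.
In `ℝ≥0∞` one has `0 / 0 = 0` and `a / 0 = ∞` for `a ≠ 0`, so that, for real `c ≥ 0`,
`‖A‖_H ≤ c` holds if and only if `‖A x‖_H ≤ c ‖x‖_H` for all `x`. -/
def opSeminorm {ι : Type*} [Fintype ι] (H A : Matrix ι ι ℝ) : ENNReal :=
  ⨆ (x : ι → ℝ) (_ : x ≠ 0),
    ENNReal.ofReal (vecSeminorm H (A *ᵥ x)) / ENNReal.ofReal (vecSeminorm H x)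

/-! ### The Moore-Penrose pseudo-inverse -/

/-- The four Penrose equations: `B` is the Moore-Penrose pseudo-inverse of `A`. -/
structure IsMoorePenrose {ι : Type*} [Fintype ι] (A B : Matrix ι ι ℝ) : Prop where
  mul_mul_left : A * B * A = A
  mul_mul_right : B * A * B = B
  symm_left : (A * B)ᵀ = A * B
  symm_right : (B * A)ᵀ = B * A

theorem IsMoorePenrose.unique {ι : Type*} [Fintype ι] {A B C : Matrix ι ι ℝ}
    (hB : IsMoorePenrose A B) (hC : IsMoorePenrose A C) : B = C := by
  have h1 : A * B = A * C := by
    calc A * B = (A * B)ᵀ := hB.symm_left.symm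
      _ = (A * C * (A * B))ᵀ := by rw [← Matrix.mul_assoc, hC.mul_mul_left]
      _ = (A * B)ᵀ * (A * C)ᵀ := Matrix.transpose_mul _ _
      _ = A * B * A * C := by rw [hB.symm_left, hC.symm_left, Matrix.mul_assoc (A * B)]
      _ = A * C := by rw [hB.mul_mul_left]
  have h2 : B * A = C * A := by
    calc B * A = (B * A)ᵀ := hB.symm_right.symm
      _ = (B * A * (C * A))ᵀ := by
        rw [Matrix.mul_assoc, ← Matrix.mul_assoc A, hC.mul_mul_left]
      _ = (C * A)ᵀ * (B * A)ᵀ := Matrix.transpose_mul _ _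
      _ = C * (A * B * A) := by
        rw [hB.symm_right, hC.symm_right, Matrix.mul_assoc, Matrix.mul_assoc]
      _ = C * A := by rw [hB.mul_mul_left]
  calc B = B * A * B := hB.mul_mul_right.symm
    _ = C * (A * B) := by rw [h2, Matrix.mul_assoc]
    _ = C := by rw [h1, ← Matrix.mul_assoc, hC.mul_mul_right]

theorem exists_isMoorePenrose_of_isHermitian {ι : Type*} [Fintype ι] [DecidableEq ι]
    {A : Matrix ι ι ℝ} (hA : A.IsHermitian) : ∃ B, IsMoorePenrose A B ∧ Bᵀ = B := by
  obtain ⟨f, e, rfl⟩ : ∃ (f : Matrix ι ι ℝ ≃⋆ₐ[ℝ] Matrix ι ι ℝ) (e : ι → ℝ),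
      A = f (Matrix.diagonal e) :=
    ⟨Unitary.conjStarAlgAut ℝ _ hA.eigenvectorUnitary, hA.eigenvalues, hA.spectral_theorem⟩
  have hT : ∀ d : ι → ℝ, (f (Matrix.diagonal d))ᵀ = f (Matrix.diagonal d) := by
    intro d
    have h : star (f (Matrix.diagonal d)) = f (Matrix.diagonal d) := by
      rw [← map_star]; simp [Matrix.star_eq_conjTranspose]
    simpa [Matrix.star_eq_conjTranspose, Matrix.conjTranspose_eq_transpose_of_trivial] using h
  refine ⟨f (Matrix.diagonal fun i => (e i)⁻¹), ⟨?_, ?_, ?_, ?_⟩, hT _⟩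
  · simp only [← map_mul, Matrix.diagonal_mul_diagonal]
    congr 2; ext i; exact mul_inv_mul_cancel _
  · simp only [← map_mul, Matrix.diagonal_mul_diagonal]
    congr 2; ext i; simpa using mul_inv_mul_cancel (e i)⁻¹
  · simp only [← map_mul, Matrix.diagonal_mul_diagonal]
    exact hT _
  · simp only [← map_mul, Matrix.diagonal_mul_diagonal]
    exact hT _

theorem exists_isMoorePenrose {ι : Type*} [Fintype ι] (A : Matrix ι ι ℝ) :
    ∃ B, IsMoorePenrose A B := by
  classical
  have hH : (Aᵀ * A).IsHermitian := by
    simp [Matrix.IsHermitian, Matrix.conjTranspose_eq_transpose_of_trivial]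
  obtain ⟨P, hP, hPt⟩ := exists_isMoorePenrose_of_isHermitian hH
  have hz : A * (P * (Aᵀ * A) - 1) = 0 := by
    rw [← Matrix.conjTranspose_mul_self_eq_zero, Matrix.conjTranspose_eq_transpose_of_trivial,
      Matrix.transpose_mul, Matrix.mul_assoc]
    have : Aᵀ * (A * (P * (Aᵀ * A) - 1)) = 0 := by
      have h := hP.mul_mul_left
      rw [← Matrix.mul_assoc, Matrix.mul_sub, ← Matrix.mul_assoc, h, Matrix.mul_one, sub_self]
    rw [this, Matrix.mul_zero]
  have hA : A * (P * (Aᵀ * A)) = A := by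
    rw [Matrix.mul_sub, Matrix.mul_one, sub_eq_zero] at hz
    exact hz
  refine ⟨P * Aᵀ, ?_, ?_, ?_, ?_⟩
  · simpa only [Matrix.mul_assoc] using hA
  · have h := hP.mul_mul_right
    calc P * Aᵀ * A * (P * Aᵀ) = P * (Aᵀ * A) * P * Aᵀ := by simp only [Matrix.mul_assoc]
      _ = P * Aᵀ := by rw [h]
  · simp only [Matrix.transpose_mul, Matrix.transpose_transpose, hPt, Matrix.mul_assoc]
  · have h := hP.symm_right
    simpa only [Matrix.mul_assoc] using h

/-- The Moore-Penrose pseudo-inverse `A⁺` of a real square matrix. -/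
def pinv {ι : Type*} [Fintype ι] (A : Matrix ι ι ℝ) : Matrix ι ι ℝ :=
  (exists_isMoorePenrose A).choose

theorem isMoorePenrose_pinv {ι : Type*} [Fintype ι] (A : Matrix ι ι ℝ) :
    IsMoorePenrose A (pinv A) :=
  (exists_isMoorePenrose A).choose_spec

/-! ### The cycle-lifted graph and the approximate LU factorization -/

/-- The `2 ^ k` layers of the cycle-lifted graph. For `k > 0` they are listed as a first half
(left summand) followed by a last half (right summand), each of which is a copy of `Layer (k-1)`. -/
def Layer : ℕ → Type
  | 0 => Unit
  | k + 1 => Layer k ⊕ Layer k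

instance Layer.instFintype : (k : ℕ) → Fintype (Layer k)
  | 0 => inferInstanceAs (Fintype Unit)
  | k + 1 =>
    letI := Layer.instFintype k
    inferInstanceAs (Fintype (Layer k ⊕ Layer k))

instance Layer.instDecidableEq : (k : ℕ) → DecidableEq (Layer k)
  | 0 => inferInstanceAs (DecidableEq Unit)
  | k + 1 =>
    letI := Layer.instDecidableEq k
    inferInstanceAs (DecidableEq (Layer k ⊕ Layer k))

/-- The adjacency matrix `C_{2^k}` of the directed cycle on `2 ^ k` vertices, in the ordering of
the vertices for which `C_1 = [1]` and `C_{2^(k+1)} = [[0, C_{2^k}], [I, 0]]`. -/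
def cycleMatrix : (k : ℕ) → Matrix (Layer k) (Layer k) ℝ
  | 0 => 1
  | k + 1 => Matrix.fromBlocks 0 (cycleMatrix k) 1 0

variable {V : Type*} [DecidableEq V]

/-- The matrix `[[A, B], [C, D]]` of size `2 ^ (k+1) n`, with four blocks of size `2 ^ k n`. -/
def blocks {k : ℕ} (A B C D : Matrix (Layer k × V) (Layer k × V) ℝ) :
    Matrix (Layer (k + 1) × V) (Layer (k + 1) × V) ℝ :=
  Matrix.reindex (Equiv.sumProdDistrib (Layer k) (Layer k) V).symm
    (Equiv.sumProdDistrib (Layer k) (Layer k) V).symm (Matrix.fromBlocks A B C D)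

/-- The Laplacian `I - C_{2^k} ⊗ W` of the cycle-lifted graph of length `2 ^ k`. -/
def cycleLaplacian (k : ℕ) (W : Matrix V V ℝ) : Matrix (Layer k × V) (Layer k × V) ℝ :=
  1 - cycleMatrix k ⊗ₖ W

/-- `lastBlock k i M` is the matrix `[[I, 0], [0, M]]` of size `2 ^ k n` whose last block `M`
has size `2 ^ (k-i) n`, for a family of matrices `M m` of size `2 ^ m n`.
(It is only used for `i ≤ k`.) -/
def lastBlock (M : (m : ℕ) → Matrix (Layer m × V) (Layer m × V) ℝ) :
    (k i : ℕ) → Matrix (Layer k × V) (Layer k × V) ℝ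
  | k, 0 => M k
  | 0, _ + 1 => 1
  | k + 1, i + 1 => blocks 1 0 0 (lastBlock M k i)

/-- The unit lower triangular matrix `[[I, 0], [-I ⊗ W, I]]` of size `2 ^ m n`. -/
def lowerBlock (W : Matrix V V ℝ) : (m : ℕ) → Matrix (Layer m × V) (Layer m × V) ℝ
  | 0 => 1
  | m + 1 => blocks 1 0 (-((1 : Matrix (Layer m) (Layer m) ℝ) ⊗ₖ W)) 1

/-- The unit upper triangular matrix `[[I, -C_{2^(m-1)} ⊗ W], [0, I]]` of size `2 ^ m n`. -/
def upperBlock (W : Matrix V V ℝ) : (m : ℕ) → Matrix (Layer m × V) (Layer m × V) ℝ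
  | 0 => 1
  | m + 1 => blocks 1 (-(cycleMatrix m ⊗ₖ W)) 0 1

/-- The factor `X_{j+1}` (for `j < k`), which is
`[[I, 0, 0], [0, I, 0], [0, -I ⊗ W_j, I]]` with blocks of sizes
`(2 ^ k - 2 ^ (k-j)) n`, `2 ^ (k-j-1) n`, `2 ^ (k-j-1) n`. -/
def lowerFactor (W : ℕ → Matrix V V ℝ) (k j : ℕ) : Matrix (Layer k × V) (Layer k × V) ℝ :=
  lastBlock (lowerBlock (W j)) k j

/-- The factor `Y_{j+1}` (for `j < k`), which is
`[[I, 0, 0], [0, I, -C_{2^(k-j-1)} ⊗ W_j], [0, 0, I]]` with blocks of sizes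
`(2 ^ k - 2 ^ (k-j)) n`, `2 ^ (k-j-1) n`, `2 ^ (k-j-1) n`. -/
def upperFactor (W : ℕ → Matrix V V ℝ) (k j : ℕ) : Matrix (Layer k × V) (Layer k × V) ℝ :=
  lastBlock (upperBlock (W j)) k j

/-- The matrix obtained after `i ≤ k` steps of the approximate LU factorization,
`L^(i) = X_1 ⋯ X_i [[I, 0], [0, I - C_{2^(k-i)} ⊗ W_i]] Y_i ⋯ Y_1`. -/
def approxLU [Fintype V] (W : ℕ → Matrix V V ℝ) (k i : ℕ) :
    Matrix (Layer k × V) (Layer k × V) ℝ :=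
  ((List.range i).map (lowerFactor W k)).prod *
    lastBlock (fun m => cycleLaplacian m (W i)) k i *
    ((List.range i).map (upperFactor W k)).reverse.prod

end CycleLift

end

open CycleLift

/-! Let `F` be the sum of the symmetrizations of `S_0, …, S_k`, each embedded in its last block.
Here `S_0 = L`, and `S_i = I - C ⊗ W_{i-1}²` is the exact Schur complement of `I - C ⊗ W_{i-1}` onto
its last half. Write `E` for the quadratic form of `F` and `δ = ε/k`.

Diagonalizing the cycle turns unit-circle approximation into a bound on `C ⊗ (W_{i-1}² - W_i)`
relative to `S_i`. The matrix `L - L̃` is the sum of the embedded differences `S_i - (I - C ⊗ W_i)`.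
Hence `|xᵀ(L - L̃)y|² ≤ δ² E(x) E(y)` (`IsChain.sq_error_le`).

Suppose `L̃v = (L̃ - L)x`, and let `m` be the largest level form of `v`, so that `E(v) ≤ (k+1)m`.
Extending the last block of `v` at a maximizing level upwards gives a vector `y` with `yᵀL̃v ≥
(1-ε)m` and `E(y) ≤ 2(k+1)m` (`IsChain.exists_test_vector`). Comparing `yᵀL̃v` with the error bound
gives `E(v) ≤ 32 ε² E(x)` (`IsChain.energy_le_of_mulVec_eq`).

The case `x = 0` controls the kernel of `L̃`, which shows that `v = (I - L̃⁺L)x` satisfies the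
equation. Finally `U_L ⪯ F` because `S_0 = L`. Each passage to a Schur complement at most triples
the form, whence `F ⪯ 2·4^k U_L`. -/

noncomputable section

namespace CycleLift

set_option linter.unusedSectionVars false

/-! ### Block decomposition of vectors on the layered vertex set -/

section Blocks

variable {V : Type*} {k : ℕ} {R : Type*}

/-- The restriction of a vector to the first half of the layers. -/
def firstHalf (x : Layer (k + 1) × V → R) : Layer k × V → R := fun p => x (Sum.inl p.1, p.2)

/-- The restriction of a vector to the last half of the layers. -/
def lastHalf (x : Layer (k + 1) × V → R) : Layer k × V → R := fun p => x (Sum.inr p.1, p.2)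

/-- The vector with prescribed halves. -/
def glue (a b : Layer k × V → R) : Layer (k + 1) × V → R :=
  fun p => Sum.elim (fun l => a (l, p.2)) (fun l => b (l, p.2)) p.1

@[simp] theorem firstHalf_glue (a b : Layer k × V → R) : firstHalf (glue a b) = a := rfl

@[simp] theorem lastHalf_glue (a b : Layer k × V → R) : lastHalf (glue a b) = b := rfl

variable [Fintype V]

theorem sum_layer_succ {M : Type*} [AddCommMonoid M] (f : Layer (k + 1) × V → M) :
    ∑ p, f p = ∑ p : Layer k × V, f (Sum.inl p.1, p.2) +
      ∑ p : Layer k × V, f (Sum.inr p.1, p.2) := by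
  exact ((Equiv.sumProdDistrib (Layer k) (Layer k) V).symm.sum_comp f).symm.trans
    (Fintype.sum_sum_type _)

theorem dotProduct_layer_succ (x y : Layer (k + 1) × V → ℝ) :
    x ⬝ᵥ y = firstHalf x ⬝ᵥ firstHalf y + lastHalf x ⬝ᵥ lastHalf y :=
  sum_layer_succ _

variable [DecidableEq V]

theorem firstHalf_blocks_mulVec (A B C D : Matrix (Layer k × V) (Layer k × V) ℝ)
    (x : Layer (k + 1) × V → ℝ) :
    firstHalf (blocks A B C D *ᵥ x) = A *ᵥ firstHalf x + B *ᵥ lastHalf x := by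
  funext p
  exact sum_layer_succ _

theorem lastHalf_blocks_mulVec (A B C D : Matrix (Layer k × V) (Layer k × V) ℝ)
    (x : Layer (k + 1) × V → ℝ) :
    lastHalf (blocks A B C D *ᵥ x) = C *ᵥ firstHalf x + D *ᵥ lastHalf x := by
  funext p
  exact sum_layer_succ _

theorem blocks_mul (A B C D A' B' C' D' : Matrix (Layer k × V) (Layer k × V) ℝ) :
    blocks A B C D * blocks A' B' C' D' =
      blocks (A * A' + B * C') (A * B' + B * D') (C * A' + D * C') (C * B' + D * D') := by
  unfold blocks
  rw [Matrix.reindex_apply, Matrix.reindex_apply, Matrix.reindex_apply,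
    ← Matrix.fromBlocks_multiply]
  exact (Matrix.submatrix_mul_equiv _ _ _ _ _)

theorem blocks_one :
    blocks (1 : Matrix (Layer k × V) (Layer k × V) ℝ) 0 0 1 = 1 := by
  unfold blocks
  rw [Matrix.fromBlocks_one, Matrix.reindex_apply]
  exact Matrix.submatrix_one_equiv _

theorem blocks_sub (A B C D A' B' C' D' : Matrix (Layer k × V) (Layer k × V) ℝ) :
    blocks A B C D - blocks A' B' C' D' = blocks (A - A') (B - B') (C - C') (D - D') := by
  ext ⟨l, v⟩ ⟨l', v'⟩
  rcases l with l | l <;> rcases l' with l' | l' <;> rfl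

theorem blocks_transpose (A B C D : Matrix (Layer k × V) (Layer k × V) ℝ) :
    (blocks A B C D)ᵀ = blocks Aᵀ Cᵀ Bᵀ Dᵀ := by
  ext ⟨l, v⟩ ⟨l', v'⟩
  rcases l with l | l <;> rcases l' with l' | l' <;> rfl

theorem cycleMatrix_succ_kronecker (A : Matrix V V ℝ) :
    cycleMatrix (k + 1) ⊗ₖ A =
      blocks 0 (cycleMatrix k ⊗ₖ A) ((1 : Matrix (Layer k) (Layer k) ℝ) ⊗ₖ A) 0 := by
  ext ⟨l, v⟩ ⟨l', v'⟩
  rcases l with l | l <;> rcases l' with l' | l'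
  · exact zero_mul _
  · rfl
  · rfl
  · exact zero_mul _

theorem cycleLaplacian_succ (A : Matrix V V ℝ) :
    cycleLaplacian (k + 1) A =
      blocks 1 (-(cycleMatrix k ⊗ₖ A)) (-((1 : Matrix (Layer k) (Layer k) ℝ) ⊗ₖ A)) 1 := by
  rw [cycleLaplacian, cycleMatrix_succ_kronecker, ← blocks_one, blocks_sub]
  simp

theorem one_kronecker_mul_cycleMatrix_kronecker (A B : Matrix V V ℝ) :
    ((1 : Matrix (Layer k) (Layer k) ℝ) ⊗ₖ A) * (cycleMatrix k ⊗ₖ B) =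
      cycleMatrix k ⊗ₖ (A * B) := by
  rw [← Matrix.mul_kronecker_mul, Matrix.one_mul]

/-! ### Recursive form of the approximate LU factorization -/

theorem prod_map_blocks {ι : Type*} (l : List ι) (f : ι → Matrix (Layer k × V) (Layer k × V) ℝ) :
    (l.map fun i => blocks 1 0 0 (f i)).prod = blocks 1 0 0 (l.map f).prod := by
  induction l with
  | nil => simpa using blocks_one.symm
  | cons a l ih => simp [ih, blocks_mul]

theorem approxLU_zero_right (W : ℕ → Matrix V V ℝ) (k : ℕ) :
    approxLU W k 0 = cycleLaplacian k (W 0) := by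
  cases k <;> simp [approxLU, lastBlock]

/-- All factors but the outermost pair have the form `diag(I, ·)` and multiply to the shorter
factorization of the shifted sequence. The outer pair adds `(I ⊗ W 0)(C ⊗ W 0) = C ⊗ W 0 ^ 2` to the
corner. -/
theorem approxLU_succ (W : ℕ → Matrix V V ℝ) (k i : ℕ) :
    approxLU W (k + 1) (i + 1) =
      blocks 1 (-(cycleMatrix k ⊗ₖ W 0)) (-((1 : Matrix (Layer k) (Layer k) ℝ) ⊗ₖ W 0))
        (cycleMatrix k ⊗ₖ (W 0 ^ 2) + approxLU (fun j => W (j + 1)) k i) := by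
  have hl : ∀ j, lowerFactor W (k + 1) (j + 1) =
      blocks 1 0 0 (lowerFactor (fun j => W (j + 1)) k j) := fun _ => rfl
  have hu : ∀ j, upperFactor W (k + 1) (j + 1) =
      blocks 1 0 0 (upperFactor (fun j => W (j + 1)) k j) := fun _ => rfl
  have hl0 : lowerFactor W (k + 1) 0 =
      blocks 1 0 (-((1 : Matrix (Layer k) (Layer k) ℝ) ⊗ₖ W 0)) 1 := rfl
  have hu0 : upperFactor W (k + 1) 0 = blocks 1 (-(cycleMatrix k ⊗ₖ W 0)) 0 1 := rfl
  have hm : lastBlock (fun m => cycleLaplacian m (W (i + 1))) (k + 1) (i + 1) =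
      blocks 1 0 0 (lastBlock (fun m => cycleLaplacian m (W (i + 1))) k i) := rfl
  simp only [approxLU, List.range_succ_eq_map, List.map_cons, List.map_map, Function.comp_def,
    Nat.succ_eq_add_one, hl, hu, List.prod_cons, List.reverse_cons, List.prod_append,
    List.prod_nil, mul_one, hm, hl0, hu0, ← List.map_reverse, prod_map_blocks, blocks_mul,
    Matrix.one_mul, Matrix.zero_mul, Matrix.mul_zero, add_zero, zero_add,
    Matrix.neg_mul, Matrix.mul_neg, neg_neg, neg_zero,
    one_kronecker_mul_cycleMatrix_kronecker, pow_two]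

end Blocks

section Fourier

/-! ### Diagonalization of the cycle -/

/-- A unitary diagonalization of `C`, with unimodular eigenvalues, yields one of
`[[0, C], [1, 0]]`. -/
theorem exists_diagonalization_fromBlocks {ι : Type*} [Fintype ι] [DecidableEq ι]
    {C Φ : Matrix ι ι ℂ} {d : ι → ℂ} (hΦ : Φ * Φᴴ = 1) (hd : ∀ a, ‖d a‖ = 1)
    (hC : C = Φ * Matrix.diagonal d * Φᴴ) :
    ∃ (Ψ : Matrix (ι ⊕ ι) (ι ⊕ ι) ℂ) (s : ι ⊕ ι → ℂ), Ψ * Ψᴴ = 1 ∧ (∀ a, ‖s a‖ = 1) ∧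
      Matrix.fromBlocks 0 C 1 0 = Ψ * Matrix.diagonal s * Ψᴴ := by
  -- If `Cφ = s²φ`, then stacking `±sφ` over `φ` gives eigenvectors of `[[0, C], [1, 0]]` for `±s`.
  -- The factor `1/√2` normalizes them.
  choose s hs using fun a => IsAlgClosed.exists_pow_nat_eq (d a) (n := 2) (by norm_num)
  have hs1 : ∀ a, ‖s a‖ = 1 := fun a => by
    have h : ‖s a‖ ^ 2 = 1 := by rw [← norm_pow, hs, hd]
    exact (pow_eq_one_iff_of_nonneg (norm_nonneg _) two_ne_zero).1 h
  obtain ⟨D, hD⟩ : ∃ D, D = Matrix.diagonal s := ⟨_, rfl⟩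
  have hDD : D * D = Matrix.diagonal d := by
    rw [hD, Matrix.diagonal_mul_diagonal]
    congr 1; funext a; rw [← hs a, pow_two]
  have hDs : D * Dᴴ = 1 := by
    rw [hD, Matrix.diagonal_conjTranspose, Matrix.diagonal_mul_diagonal, ← Matrix.diagonal_one]
    congr 1; funext a
    simpa [hs1 a] using Complex.mul_conj' (s a)
  obtain ⟨c, hc⟩ : ∃ c : ℂ, c = ((√2 : ℝ) : ℂ)⁻¹ := ⟨_, rfl⟩
  have hcc : star c = c := by simp [hc]
  have hc2 : c * c = 1 / 2 := by
    rw [hc, ← mul_inv, ← Complex.ofReal_mul, Real.mul_self_sqrt (by norm_num)]; simp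
  have hhalf : ∀ M : Matrix ι ι ℂ, (1 / 2 : ℂ) • (M + M) = M := fun M => by
    rw [← two_smul ℂ M, smul_smul]; norm_num
  have h1 : Φ * D * (Dᴴ * Φᴴ) = 1 := by
    rw [Matrix.mul_assoc, ← Matrix.mul_assoc D, hDs, Matrix.one_mul, hΦ]
  refine ⟨c • Matrix.fromBlocks (Φ * D) (-(Φ * D)) Φ Φ, Sum.elim s (-s), ?_, ?_, ?_⟩
  · rw [Matrix.conjTranspose_smul, hcc, Matrix.smul_mul, Matrix.mul_smul, smul_smul, hc2,
      Matrix.fromBlocks_conjTranspose, Matrix.fromBlocks_multiply, Matrix.fromBlocks_smul]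
    simp only [Matrix.conjTranspose_neg, Matrix.conjTranspose_mul, Matrix.neg_mul,
      Matrix.mul_neg, neg_neg]
    rw [h1, hΦ, hhalf]
    simp only [add_neg_cancel, smul_zero]
    exact Matrix.fromBlocks_one
  · rintro (a | a) <;> simp [hs1]
  · have hdiag : Matrix.diagonal (Sum.elim s (-s)) = Matrix.fromBlocks D 0 0 (-D) := by
      rw [hD, ← Matrix.fromBlocks_diagonal]; congr 1; simp
    rw [hC, Matrix.conjTranspose_smul, hcc, Matrix.mul_smul, Matrix.smul_mul, Matrix.smul_mul,
      smul_smul, hc2, ← hDD, hdiag, Matrix.fromBlocks_conjTranspose, Matrix.fromBlocks_multiply,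
      Matrix.fromBlocks_multiply, Matrix.fromBlocks_smul]
    simp only [Matrix.conjTranspose_neg, Matrix.conjTranspose_mul, Matrix.neg_mul,
      Matrix.mul_neg, neg_neg, Matrix.mul_zero, add_zero, zero_add]
    rw [h1, ← Matrix.mul_assoc Φ D D, hhalf, hhalf]
    simp only [add_neg_cancel, smul_zero]

/-- The matrix `C_{2^k}` is unitarily diagonalizable with eigenvalues on the unit circle. -/
theorem exists_diagonalization_cycleMatrix (k : ℕ) :
    ∃ (Φ : Matrix (Layer k) (Layer k) ℂ) (d : Layer k → ℂ), Φ * Φᴴ = 1 ∧ (∀ a, ‖d a‖ = 1) ∧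
      toComplex (cycleMatrix k) = Φ * Matrix.diagonal d * Φᴴ := by
  induction k with
  | zero =>
    refine ⟨1, fun _ => 1, by simp, by simp, ?_⟩
    simp [toComplex, cycleMatrix, Matrix.map_one]
  | succ k ih =>
    obtain ⟨Φ, d, hΦ, hd, hC⟩ := ih
    have hT : toComplex (cycleMatrix (k + 1)) =
        Matrix.fromBlocks 0 (toComplex (cycleMatrix k)) 1 0 := by
      refine (Matrix.fromBlocks_map _ _ _ _ _).trans ?_
      simp [toComplex, Matrix.map_one]
    rw [hT]
    exact exists_diagonalization_fromBlocks hΦ hd hC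

variable {V : Type*} [Fintype V]

theorem ofReal_dotProduct_mulVec {ι : Type*} [Fintype ι] (N : Matrix ι ι ℝ) (x y : ι → ℝ) :
    ((x ⬝ᵥ (N *ᵥ y) : ℝ) : ℂ) =
      star (fun i => (x i : ℂ)) ⬝ᵥ (toComplex N *ᵥ fun i => (y i : ℂ)) := by
  simp [dotProduct, Matrix.mulVec, toComplex]

/-- A bilinear form of a lifted matrix, in Fourier coordinates. -/
theorem dotProduct_diagonal_kronecker {ι : Type*} [Fintype ι] [DecidableEq ι] (d : ι → ℂ)
    (M : Matrix V V ℂ) (x y : ι × V → ℂ) :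
    star x ⬝ᵥ ((Matrix.diagonal d ⊗ₖ M) *ᵥ y) =
      ∑ a, d a * (star (fun v => x (a, v)) ⬝ᵥ (M *ᵥ fun v => y (a, v))) := by
  simp only [dotProduct, Matrix.mulVec, Matrix.kroneckerMap_apply, Fintype.sum_prod_type,
    Matrix.diagonal_apply, ite_mul, zero_mul, Finset.sum_ite_irrel, Finset.sum_const_zero,
    Finset.sum_ite_eq, Finset.mem_univ, if_true, Pi.star_apply, Finset.mul_sum]
  refine Finset.sum_congr rfl fun a _ => Finset.sum_congr rfl fun v _ =>
    Finset.sum_congr rfl fun w _ => by ring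

/-- Unit-circle approximation is preserved by the cycle lift. -/
theorem UnitCircleApprox.cycleLift {δ : ℝ} {B A : Matrix V V ℝ} (hδ : 0 ≤ δ)
    (h : UnitCircleApprox δ (toComplex B) (toComplex A)) (k : ℕ) (x y : Layer k × V → ℝ) :
    |x ⬝ᵥ ((cycleMatrix k ⊗ₖ (A - B)) *ᵥ y)| ≤
      δ / 2 * (x ⬝ᵥ x + y ⬝ᵥ y - x ⬝ᵥ ((cycleMatrix k ⊗ₖ A) *ᵥ x) -
        y ⬝ᵥ ((cycleMatrix k ⊗ₖ A) *ᵥ y)) := by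
  classical
  obtain ⟨Φ, d, hΦ, hd, hC⟩ := exists_diagonalization_cycleMatrix k
  -- In the Fourier coordinates `hat`, the lift of `M` is block diagonal with blocks `d a • M`.
  let Ψ : Matrix (Layer k × V) (Layer k × V) ℂ := Φ ⊗ₖ (1 : Matrix V V ℂ)
  let hat : (Layer k × V → ℝ) → Layer k × V → ℂ := fun x => Ψᴴ *ᵥ fun i => (x i : ℂ)
  have hΨ : Ψ * Ψᴴ = 1 := by
    simp only [Ψ, Matrix.conjTranspose_kronecker, ← Matrix.mul_kronecker_mul, hΦ,
      Matrix.conjTranspose_one, Matrix.mul_one, Matrix.one_kronecker_one]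
  have hstar : ∀ x, star (hat x) = (star fun i => (x i : ℂ)) ᵥ* Ψ := fun x => by
    simp only [hat, Matrix.star_mulVec, Matrix.conjTranspose_conjTranspose]
  have hform : ∀ (M : Matrix V V ℝ) (x y : Layer k × V → ℝ),
      ((x ⬝ᵥ ((cycleMatrix k ⊗ₖ M) *ᵥ y) : ℝ) : ℂ) =
        ∑ a, d a * (star (fun v => hat x (a, v)) ⬝ᵥ (toComplex M *ᵥ fun v => hat y (a, v))) := by
    intro M x y
    rw [← dotProduct_diagonal_kronecker, ofReal_dotProduct_mulVec, hstar,
      ← Matrix.dotProduct_mulVec, Matrix.mulVec_mulVec, Matrix.mulVec_mulVec]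
    congr 2
    have : toComplex (cycleMatrix k ⊗ₖ M) = toComplex (cycleMatrix k) ⊗ₖ toComplex M := by
      ext; simp [toComplex]
    rw [this, hC]
    simp only [Ψ, Matrix.conjTranspose_kronecker, Matrix.conjTranspose_one,
      ← Matrix.mul_kronecker_mul, Matrix.one_mul, Matrix.mul_one, Matrix.mul_assoc]
  have hnorm : ∀ x : Layer k × V → ℝ, x ⬝ᵥ x = ∑ a, ∑ v, ‖hat x (a, v)‖ ^ 2 := by
    intro x
    have h1 : ((x ⬝ᵥ x : ℝ) : ℂ) = star (hat x) ⬝ᵥ hat x := by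
      rw [hstar, ← Matrix.dotProduct_mulVec, Matrix.mulVec_mulVec, hΨ, Matrix.one_mulVec]
      simp [dotProduct]
    have h2 : star (hat x) ⬝ᵥ hat x = ((∑ a, ∑ v, ‖hat x (a, v)‖ ^ 2 : ℝ) : ℂ) := by
      simp only [dotProduct, Fintype.sum_prod_type, Pi.star_apply, Complex.ofReal_sum,
        Complex.star_def, Complex.conj_mul', Complex.ofReal_pow]
    exact_mod_cast h1.trans h2
  have hre : ∀ x : Layer k × V → ℝ, x ⬝ᵥ ((cycleMatrix k ⊗ₖ A) *ᵥ x) =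
      ∑ a, (d a * (star (fun v => hat x (a, v)) ⬝ᵥ
        (toComplex A *ᵥ fun v => hat x (a, v)))).re := fun x => by
    rw [← Complex.re_sum, ← hform, Complex.ofReal_re]
  have hsub : toComplex (A - B) = toComplex A - toComplex B := by
    ext; simp [toComplex]
  have hlhs : |x ⬝ᵥ ((cycleMatrix k ⊗ₖ (A - B)) *ᵥ y)| ≤ ∑ a,
      ‖star (fun v => hat x (a, v)) ⬝ᵥ
        ((toComplex A - toComplex B) *ᵥ fun v => hat y (a, v))‖ := by
    rw [← Real.norm_eq_abs, ← Complex.norm_real, hform, hsub]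
    refine (norm_sum_le _ _).trans (Finset.sum_le_sum fun a _ => ?_)
    rw [norm_mul, hd, one_mul]
  refine hlhs.trans ?_
  rw [hnorm x, hnorm y, hre x, hre y, ← Finset.sum_add_distrib, ← Finset.sum_sub_distrib,
    ← Finset.sum_sub_distrib, Finset.mul_sum]
  refine Finset.sum_le_sum fun a _ => (h _ _).trans ?_
  refine mul_le_mul_of_nonneg_left ?_ (by positivity)
  rw [sub_sub]
  refine sub_le_sub_left ?_ _
  -- The modulus in the unit-circle bound is unaffected by the phase `d a`, so it dominates the real
  -- part for every eigenvalue at once.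
  rw [← Complex.add_re, ← mul_add]
  refine (Complex.re_le_norm _).trans ?_
  rw [norm_mul, hd, one_mul]

end Fourier

/-! ### Contractions -/

section Contraction

variable {V : Type*} [Fintype V] {k : ℕ}

/-- `A` and its transpose do not increase the Euclidean norm. -/
structure IsContraction {ι : Type*} [Fintype ι] (A : Matrix ι ι ℝ) : Prop where
  le : ∀ x, (A *ᵥ x) ⬝ᵥ (A *ᵥ x) ≤ x ⬝ᵥ x
  transpose_le : ∀ x, (Aᵀ *ᵥ x) ⬝ᵥ (Aᵀ *ᵥ x) ≤ x ⬝ᵥ x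

theorem IsContraction.mul {ι : Type*} [Fintype ι] {A B : Matrix ι ι ℝ}
    (hA : IsContraction A) (hB : IsContraction B) : IsContraction (A * B) := by
  constructor <;> intro x
  · rw [← Matrix.mulVec_mulVec]
    exact (hA.le _).trans (hB.le _)
  · rw [Matrix.transpose_mul, ← Matrix.mulVec_mulVec]
    exact (hB.transpose_le _).trans (hA.transpose_le _)

theorem dotProduct_self_nonneg {ι : Type*} [Fintype ι] (x : ι → ℝ) : 0 ≤ x ⬝ᵥ x :=
  Finset.sum_nonneg fun i _ => mul_self_nonneg (x i)

/-- Expand `‖x - A x‖² ≥ 0`. -/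
theorem IsContraction.dotProduct_mulVec_le {ι : Type*} [Fintype ι] {A : Matrix ι ι ℝ}
    (hA : IsContraction A) (x : ι → ℝ) : x ⬝ᵥ (A *ᵥ x) ≤ x ⬝ᵥ x := by
  have h := dotProduct_self_nonneg (x - A *ᵥ x)
  simp only [sub_dotProduct, dotProduct_sub] at h
  rw [dotProduct_comm (A *ᵥ x) x] at h
  linarith [hA.le x]

theorem one_kronecker_contraction_aux {ι : Type*} [Fintype ι] [DecidableEq ι]
    {A : Matrix V V ℝ} (hA : ∀ x, (A *ᵥ x) ⬝ᵥ (A *ᵥ x) ≤ x ⬝ᵥ x) (x : ι × V → ℝ) :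
    (((1 : Matrix ι ι ℝ) ⊗ₖ A) *ᵥ x) ⬝ᵥ (((1 : Matrix ι ι ℝ) ⊗ₖ A) *ᵥ x) ≤ x ⬝ᵥ x := by
  have h : ∀ l v, (((1 : Matrix ι ι ℝ) ⊗ₖ A) *ᵥ x) (l, v) = (A *ᵥ fun w => x (l, w)) v := by
    intro l v
    simp [Matrix.mulVec, dotProduct, Fintype.sum_prod_type, Matrix.one_apply,
      Finset.sum_ite_irrel]
  simp only [dotProduct, Fintype.sum_prod_type, h]
  exact Finset.sum_le_sum fun l _ => hA fun w => x (l, w)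

theorem IsContraction.one_kronecker {ι : Type*} [Fintype ι] [DecidableEq ι]
    {A : Matrix V V ℝ} (hA : IsContraction A) : IsContraction ((1 : Matrix ι ι ℝ) ⊗ₖ A) := by
  refine ⟨one_kronecker_contraction_aux hA.le, ?_⟩
  rw [← Matrix.kroneckerMap_transpose, Matrix.transpose_one]
  exact one_kronecker_contraction_aux hA.transpose_le

theorem IsContraction.cycleMatrix_kronecker {A : Matrix V V ℝ} (hA : IsContraction A) (k : ℕ) :
    IsContraction (cycleMatrix k ⊗ₖ A) := by
  classical
  induction k with
  | zero => exact hA.one_kronecker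
  | succ k ih =>
    rw [cycleMatrix_succ_kronecker]
    constructor <;> intro x
    · rw [dotProduct_layer_succ, dotProduct_layer_succ x, firstHalf_blocks_mulVec,
        lastHalf_blocks_mulVec]
      simp only [Matrix.zero_mulVec, zero_add, add_zero]
      linarith [ih.le (lastHalf x), hA.one_kronecker.le (firstHalf x)]
    · rw [blocks_transpose, dotProduct_layer_succ, dotProduct_layer_succ x,
        firstHalf_blocks_mulVec, lastHalf_blocks_mulVec]
      simp only [Matrix.transpose_zero, Matrix.zero_mulVec, zero_add, add_zero]
      linarith [ih.transpose_le (firstHalf x), hA.one_kronecker.transpose_le (lastHalf x)]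

end Contraction

/-! ### Quadratic forms of Laplacians -/

section Forms

variable {V : Type*} [Fintype V] [DecidableEq V] {k : ℕ}

/-- The quadratic form of the Laplacian of the cycle lift. -/
def lapForm (k : ℕ) (A : Matrix V V ℝ) (x : Layer k × V → ℝ) : ℝ :=
  x ⬝ᵥ (cycleLaplacian k A *ᵥ x)

theorem lapForm_eq (A : Matrix V V ℝ) (x : Layer k × V → ℝ) :
    lapForm k A x = x ⬝ᵥ x - x ⬝ᵥ ((cycleMatrix k ⊗ₖ A) *ᵥ x) := by
  rw [lapForm, cycleLaplacian, Matrix.sub_mulVec, Matrix.one_mulVec, dotProduct_sub]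

theorem lapForm_nonneg {A : Matrix V V ℝ} (hA : IsContraction A) (x : Layer k × V → ℝ) :
    0 ≤ lapForm k A x := by
  rw [lapForm_eq]
  linarith [(hA.cycleMatrix_kronecker k).dotProduct_mulVec_le x]

/-- `‖Lᵀ x‖² ≤ 2 xᵀ L x`. -/
theorem transpose_cycleLaplacian_mulVec_le {A : Matrix V V ℝ} (hA : IsContraction A)
    (x : Layer k × V → ℝ) :
    ((cycleLaplacian k A)ᵀ *ᵥ x) ⬝ᵥ ((cycleLaplacian k A)ᵀ *ᵥ x) ≤ 2 * lapForm k A x := by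
  have h := (hA.cycleMatrix_kronecker k).transpose_le x
  have e : x ⬝ᵥ ((cycleMatrix k ⊗ₖ A) *ᵥ x) = x ⬝ᵥ ((cycleMatrix k ⊗ₖ A)ᵀ *ᵥ x) := by
    rw [Matrix.dotProduct_mulVec, ← Matrix.mulVec_transpose, dotProduct_comm]
  rw [lapForm_eq, e, cycleLaplacian, Matrix.transpose_sub, Matrix.transpose_one,
    Matrix.sub_mulVec, Matrix.one_mulVec]
  simp only [sub_dotProduct, dotProduct_sub]
  rw [dotProduct_comm ((cycleMatrix k ⊗ₖ A)ᵀ *ᵥ x) x]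
  linarith

theorem lapForm_succ (A : Matrix V V ℝ) (x : Layer (k + 1) × V → ℝ) :
    lapForm (k + 1) A x = firstHalf x ⬝ᵥ firstHalf x + lastHalf x ⬝ᵥ lastHalf x -
      firstHalf x ⬝ᵥ ((cycleMatrix k ⊗ₖ A) *ᵥ lastHalf x) -
      firstHalf x ⬝ᵥ (((1 : Matrix (Layer k) (Layer k) ℝ) ⊗ₖ A)ᵀ *ᵥ lastHalf x) := by
  rw [lapForm_eq, cycleMatrix_succ_kronecker, dotProduct_layer_succ, dotProduct_layer_succ,
    firstHalf_blocks_mulVec, lastHalf_blocks_mulVec]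
  simp only [Matrix.zero_mulVec, zero_add, add_zero]
  rw [Matrix.dotProduct_mulVec (lastHalf x), ← Matrix.mulVec_transpose,
    dotProduct_comm (_ *ᵥ _) (firstHalf x)]
  ring

theorem lapForm_sq (A : Matrix V V ℝ) (x : Layer k × V → ℝ) :
    lapForm k (A ^ 2) x = x ⬝ᵥ x - (((1 : Matrix (Layer k) (Layer k) ℝ) ⊗ₖ A)ᵀ *ᵥ x) ⬝ᵥ
      ((cycleMatrix k ⊗ₖ A) *ᵥ x) := by
  rw [lapForm_eq, pow_two, ← one_kronecker_mul_cycleMatrix_kronecker, ← Matrix.mulVec_mulVec,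
    Matrix.dotProduct_mulVec, ← Matrix.mulVec_transpose]

/-- The form of the Schur complement is at most twice the form of the Laplacian. -/
theorem lapForm_sq_lastHalf_le {A : Matrix V V ℝ} (hA : IsContraction A)
    (x : Layer (k + 1) × V → ℝ) :
    lapForm k (A ^ 2) (lastHalf x) ≤ 2 * lapForm (k + 1) A x := by
  rw [lapForm_succ, lapForm_sq]
  have h1 := (hA.cycleMatrix_kronecker k).le (lastHalf x)
  have h2 := (hA.one_kronecker (ι := Layer k)).transpose_le (lastHalf x)
  set a := (cycleMatrix k ⊗ₖ A) *ᵥ lastHalf x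
  set b := ((1 : Matrix (Layer k) (Layer k) ℝ) ⊗ₖ A)ᵀ *ᵥ lastHalf x
  -- Complete the square in the first half, whose optimal value is `(a + b) / 2`. The leftover `‖a‖²
  -- + ‖b‖²` is at most `2‖lastHalf x‖²` by contraction.
  have h3 := dotProduct_self_nonneg ((2 : ℝ) • firstHalf x - (a + b))
  simp only [sub_dotProduct, dotProduct_sub, add_dotProduct, dotProduct_add, smul_dotProduct,
    dotProduct_smul, smul_eq_mul] at h3
  rw [dotProduct_comm a (firstHalf x), dotProduct_comm b (firstHalf x), dotProduct_comm a b] at h3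
  linarith

/-- The form of the Laplacian at the harmonic extension is the form of the Schur complement. -/
theorem lapForm_glue (A : Matrix V V ℝ) (y : Layer k × V → ℝ) :
    lapForm (k + 1) A (glue (((1 : Matrix (Layer k) (Layer k) ℝ) ⊗ₖ A)ᵀ *ᵥ y) y) =
      lapForm k (A ^ 2) y := by
  -- The extension is harmonic for left multiplication only. Its first half is `b = (I ⊗ A)ᵀ y`, so
  -- the two terms `b ⬝ᵥ b` cancel.
  rw [lapForm_succ, lapForm_sq, firstHalf_glue, lastHalf_glue]
  ring

/-- `B` approximates `A`, relative to the Laplacian of `A`, in every cycle lift. -/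
def LiftApprox (δ : ℝ) (B A : Matrix V V ℝ) : Prop :=
  ∀ (m : ℕ) (x y : Layer m × V → ℝ), |x ⬝ᵥ ((cycleMatrix m ⊗ₖ (A - B)) *ᵥ y)| ≤
    δ / 2 * (lapForm m A x + lapForm m A y)

theorem UnitCircleApprox.liftApprox {δ : ℝ} {B A : Matrix V V ℝ} (hδ : 0 ≤ δ)
    (h : UnitCircleApprox δ (toComplex B) (toComplex A)) : LiftApprox δ B A := fun m x y => by
  refine (h.cycleLift hδ m x y).trans_eq ?_
  rw [lapForm_eq, lapForm_eq]
  ring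

theorem LiftApprox.refl (A : Matrix V V ℝ) : LiftApprox 0 A A := fun m x y => by
  simp

theorem cycleLaplacian_sub (A B : Matrix V V ℝ) :
    cycleLaplacian k A - cycleLaplacian k B = -(cycleMatrix k ⊗ₖ (A - B)) := by
  ext i j
  simp only [cycleLaplacian, Matrix.sub_apply, Matrix.neg_apply, Matrix.kroneckerMap_apply]
  ring

theorem LiftApprox.abs_lapForm_sub_le {δ : ℝ} {B A : Matrix V V ℝ} (h : LiftApprox δ B A)
    (x : Layer k × V → ℝ) : |lapForm k B x - lapForm k A x| ≤ δ * lapForm k A x := by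
  have e : lapForm k B x - lapForm k A x = x ⬝ᵥ ((cycleMatrix k ⊗ₖ (A - B)) *ᵥ x) := by
    rw [lapForm, lapForm, ← dotProduct_sub, ← Matrix.sub_mulVec, ← neg_sub,
      cycleLaplacian_sub, neg_neg]
  rw [e]
  refine (h k x x).trans_eq ?_
  ring

/-- Eliminating the first half is exact; the error arises only from what replaces the Schur
complement. -/
theorem cycleLaplacian_sub_approxLU_succ (W : ℕ → Matrix V V ℝ) (k : ℕ) :
    cycleLaplacian (k + 1) (W 0) - approxLU W (k + 1) (k + 1) =
      blocks 0 0 0 (cycleLaplacian k (W 0 ^ 2) - approxLU (fun j => W (j + 1)) k k) := by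
  rw [approxLU_succ, cycleLaplacian_succ, blocks_sub]
  congr 1 <;> simp [cycleLaplacian, sub_sub]

/-! ### Chains -/

/-- A chain of approximate squares `A ≈ W₀`, `W₀² ≈ W₁`, …, `W_{k-1}² ≈ W_k`. -/
structure IsChain (k : ℕ) (A : Matrix V V ℝ) (W : ℕ → Matrix V V ℝ) (δ₀ δ : ℝ) : Prop where
  head_contraction : IsContraction A
  contraction : ∀ i ≤ k, IsContraction (W i)
  head_approx : LiftApprox δ₀ (W 0) A
  approx : ∀ i < k, LiftApprox δ (W (i + 1)) (W i ^ 2)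

/-- This is why a chain has a separate head: one level down, the exact square `W 0 ^ 2` is the
reference matrix and `W 1` its approximation. -/
theorem IsChain.tail {A : Matrix V V ℝ} {W : ℕ → Matrix V V ℝ} {δ₀ δ : ℝ}
    (h : IsChain (k + 1) A W δ₀ δ) : IsChain k (W 0 ^ 2) (fun j => W (j + 1)) δ δ where
  head_contraction := by
    rw [pow_two]
    exact (h.contraction 0 (by omega)).mul (h.contraction 0 (by omega))
  contraction i hi := h.contraction (i + 1) (by omega)
  head_approx := h.approx 0 (by omega)
  approx i hi := h.approx (i + 1) (by omega)

/-- The form of the `i`-th Schur complement, evaluated on the last `2 ^ (k - i)` layers. -/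
def levelForm : (k : ℕ) → Matrix V V ℝ → (ℕ → Matrix V V ℝ) → ℕ → (Layer k × V → ℝ) → ℝ
  | k, A, _, 0, x => lapForm k A x
  | 0, _, _, _ + 1, _ => 0
  | k + 1, _, W, i + 1, x => levelForm k (W 0 ^ 2) (fun j => W (j + 1)) i (lastHalf x)

theorem levelForm_zero (A : Matrix V V ℝ) (W : ℕ → Matrix V V ℝ) (x : Layer k × V → ℝ) :
    levelForm k A W 0 x = lapForm k A x := by
  cases k <;> rfl

/-- The sum of the symmetrized Schur complements, each embedded in the last block. -/
def energyMatrix : (k : ℕ) → Matrix V V ℝ → (ℕ → Matrix V V ℝ) →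
    Matrix (Layer k × V) (Layer k × V) ℝ
  | 0, A, _ => symmetrization (cycleLaplacian 0 A)
  | k + 1, A, W => symmetrization (cycleLaplacian (k + 1) A) +
      blocks 0 0 0 (energyMatrix k (W 0 ^ 2) fun j => W (j + 1))

/-- The quadratic form of `energyMatrix`. -/
def energy (k : ℕ) (A : Matrix V V ℝ) (W : ℕ → Matrix V V ℝ) (x : Layer k × V → ℝ) : ℝ :=
  x ⬝ᵥ (energyMatrix k A W *ᵥ x)

theorem transpose_symmetrization {ι : Type*} (A : Matrix ι ι ℝ) :
    (symmetrization A)ᵀ = symmetrization A := by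
  rw [symmetrization, Matrix.transpose_smul, Matrix.transpose_add, Matrix.transpose_transpose,
    add_comm]

theorem dotProduct_symmetrization_mulVec {ι : Type*} [Fintype ι] (A : Matrix ι ι ℝ) (x : ι → ℝ) :
    x ⬝ᵥ (symmetrization A *ᵥ x) = x ⬝ᵥ (A *ᵥ x) := by
  have e : x ⬝ᵥ (Aᵀ *ᵥ x) = x ⬝ᵥ (A *ᵥ x) := by
    rw [Matrix.mulVec_transpose, dotProduct_comm, ← Matrix.dotProduct_mulVec]
  rw [symmetrization, Matrix.smul_mulVec, Matrix.add_mulVec, dotProduct_smul, dotProduct_add, e,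
    smul_eq_mul]
  ring

theorem transpose_energyMatrix (A : Matrix V V ℝ) (W : ℕ → Matrix V V ℝ) (k : ℕ) :
    (energyMatrix k A W)ᵀ = energyMatrix k A W := by
  induction k generalizing A W with
  | zero => exact transpose_symmetrization _
  | succ k ih =>
    rw [energyMatrix, Matrix.transpose_add, transpose_symmetrization, blocks_transpose, ih]
    simp

theorem energy_zero (A : Matrix V V ℝ) (W : ℕ → Matrix V V ℝ) (x : Layer 0 × V → ℝ) :
    energy 0 A W x = lapForm 0 A x :=
  dotProduct_symmetrization_mulVec _ _

theorem energy_succ (A : Matrix V V ℝ) (W : ℕ → Matrix V V ℝ) (x : Layer (k + 1) × V → ℝ) :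
    energy (k + 1) A W x =
      lapForm (k + 1) A x + energy k (W 0 ^ 2) (fun j => W (j + 1)) (lastHalf x) := by
  rw [energy, energyMatrix, Matrix.add_mulVec, dotProduct_add, dotProduct_symmetrization_mulVec,
    dotProduct_layer_succ x (blocks _ _ _ _ *ᵥ x), firstHalf_blocks_mulVec,
    lastHalf_blocks_mulVec]
  simp [lapForm, energy]

theorem energy_smul (A : Matrix V V ℝ) (W : ℕ → Matrix V V ℝ) (t : ℝ) (x : Layer k × V → ℝ) :
    energy k A W (t • x) = t ^ 2 * energy k A W x := by
  simp only [energy, Matrix.mulVec_smul, smul_dotProduct, dotProduct_smul, smul_eq_mul]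
  ring

theorem IsChain.energy_nonneg {A : Matrix V V ℝ} {W : ℕ → Matrix V V ℝ} {δ₀ δ : ℝ}
    (h : IsChain k A W δ₀ δ) (x : Layer k × V → ℝ) : 0 ≤ energy k A W x := by
  induction k generalizing A W δ₀ with
  | zero => rw [energy_zero]; exact lapForm_nonneg h.head_contraction x
  | succ k ih =>
    rw [energy_succ]
    exact add_nonneg (lapForm_nonneg h.head_contraction x) (ih h.tail _)

theorem IsChain.lapForm_le_energy {A : Matrix V V ℝ} {W : ℕ → Matrix V V ℝ} {δ₀ δ : ℝ}
    (h : IsChain k A W δ₀ δ) (x : Layer k × V → ℝ) : lapForm k A x ≤ energy k A W x := by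
  cases k with
  | zero => rw [energy_zero]
  | succ k =>
    rw [energy_succ]
    exact le_add_of_nonneg_right (h.tail.energy_nonneg _)

theorem energy_le_of_levelForm_le {A : Matrix V V ℝ} {W : ℕ → Matrix V V ℝ} {m : ℝ}
    {x : Layer k × V → ℝ} (hm : ∀ j ≤ k, levelForm k A W j x ≤ m) :
    energy k A W x ≤ (k + 1) * m := by
  induction k generalizing A W with
  | zero =>
    rw [energy_zero]
    simpa [levelForm_zero] using hm 0 le_rfl
  | succ k ih =>
    rw [energy_succ]
    have h0 := hm 0 (by omega)
    rw [levelForm_zero] at h0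
    have h1 := ih fun j hj => hm (j + 1) (by omega)
    push_cast
    linarith

/-- The energy is at most `2 · 4 ^ k` times the form of the Laplacian. -/
theorem IsChain.energy_le {A : Matrix V V ℝ} {W : ℕ → Matrix V V ℝ} {δ₀ δ : ℝ}
    (h : IsChain k A W δ₀ δ) (hδ₀ : δ₀ ≤ 1 / 2) (hδ : δ ≤ 1 / 2) (x : Layer k × V → ℝ) :
    energy k A W x ≤ 2 * 4 ^ k * lapForm k A x := by
  induction k generalizing A W δ₀ with
  | zero =>
    rw [energy_zero]
    linarith [lapForm_nonneg h.head_contraction x]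
  | succ k ih =>
    rw [energy_succ]
    have h0 := lapForm_nonneg h.head_contraction x
    have h1 := ih h.tail hδ (lastHalf x)
    have h2 := lapForm_sq_lastHalf_le (h.contraction 0 (by omega)) x
    have h3 := (abs_le.1 (h.head_approx.abs_lapForm_sub_le x)).2
    -- Here `3 = 2 (1 + 1/2)`: the Schur complement costs `2`, replacing `W 0` by `A` costs `1 +
    -- δ₀`. The recursion closes since `1 + 3 · 2 · 4 ^ k ≤ 2 · 4 ^ (k + 1)`.
    have h4 : lapForm k (W 0 ^ 2) (lastHalf x) ≤ 3 * lapForm (k + 1) A x := by nlinarith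
    have h5 : (1 : ℝ) ≤ 4 ^ k := one_le_pow₀ (by norm_num)
    have h6 := mul_le_mul_of_nonneg_left h4 (by positivity : (0 : ℝ) ≤ 2 * 4 ^ k)
    have h7 := mul_le_mul_of_nonneg_right h5 h0
    rw [pow_succ (4 : ℝ)]
    linarith

/-! ### Error of the approximate factorization -/

theorem dotProduct_blocks_last (M : Matrix (Layer k × V) (Layer k × V) ℝ)
    (x y : Layer (k + 1) × V → ℝ) :
    x ⬝ᵥ (blocks 0 0 0 M *ᵥ y) = lastHalf x ⬝ᵥ (M *ᵥ lastHalf y) := by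
  rw [dotProduct_layer_succ, firstHalf_blocks_mulVec, lastHalf_blocks_mulVec]
  simp

theorem dotProduct_cycleLaplacian_sub (A B : Matrix V V ℝ) (x y : Layer k × V → ℝ) :
    x ⬝ᵥ ((cycleLaplacian k A - cycleLaplacian k B) *ᵥ y) =
      -(x ⬝ᵥ ((cycleMatrix k ⊗ₖ (A - B)) *ᵥ y)) := by
  rw [cycleLaplacian_sub, Matrix.neg_mulVec, dotProduct_neg]

/-- The error of the approximate factorization, relative to the energy. -/
theorem IsChain.abs_error_le {A : Matrix V V ℝ} {W : ℕ → Matrix V V ℝ} {δ₀ δ : ℝ}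
    (h : IsChain k A W δ₀ δ) (hδ : δ₀ ≤ δ) (x y : Layer k × V → ℝ) :
    |x ⬝ᵥ ((cycleLaplacian k A - approxLU W k k) *ᵥ y)| ≤
      δ / 2 * (energy k A W x + energy k A W y) := by
  have h1 : |x ⬝ᵥ ((cycleLaplacian k A - cycleLaplacian k (W 0)) *ᵥ y)| ≤
      δ / 2 * (lapForm k A x + lapForm k A y) := by
    rw [dotProduct_cycleLaplacian_sub, abs_neg]
    refine (h.head_approx k x y).trans (mul_le_mul_of_nonneg_right (by linarith) ?_)
    exact add_nonneg (lapForm_nonneg h.head_contraction x) (lapForm_nonneg h.head_contraction y)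
  induction k generalizing A W δ₀ with
  | zero => rwa [approxLU_zero_right, energy_zero, energy_zero]
  | succ k ih =>
    have h2 := ih h.tail le_rfl (lastHalf x) (lastHalf y) <| by
      rw [dotProduct_cycleLaplacian_sub, abs_neg]
      exact h.tail.head_approx k _ _
    -- Telescope through the Laplacian of `W 0`: the head error is charged to the top level, the
    -- rest to the levels below.
    rw [← sub_add_sub_cancel _ (cycleLaplacian (k + 1) (W 0)), Matrix.add_mulVec, dotProduct_add,
      cycleLaplacian_sub_approxLU_succ, dotProduct_blocks_last, energy_succ, energy_succ]
    refine (abs_add_le _ _).trans ((add_le_add h1 h2).trans_eq ?_)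
    ring

/-- The quadratic form of the error, relative to the largest level. -/
theorem IsChain.abs_error_self_le {A : Matrix V V ℝ} {W : ℕ → Matrix V V ℝ} {δ₀ δ : ℝ}
    (h : IsChain k A W δ₀ δ) (hδ₀ : 0 ≤ δ₀) (hδ : 0 ≤ δ) {m : ℝ} {x : Layer k × V → ℝ}
    (hm : ∀ j ≤ k, levelForm k A W j x ≤ m) :
    |x ⬝ᵥ ((cycleLaplacian k A - approxLU W k k) *ᵥ x)| ≤ (δ₀ + k * δ) * m := by
  have h1 : |x ⬝ᵥ ((cycleLaplacian k A - cycleLaplacian k (W 0)) *ᵥ x)| ≤ δ₀ * m := by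
    rw [dotProduct_cycleLaplacian_sub, abs_neg]
    have h0 := hm 0 (by omega)
    rw [levelForm_zero] at h0
    refine (h.head_approx k x x).trans ?_
    nlinarith
  induction k generalizing A W δ₀ with
  | zero => simpa [approxLU_zero_right] using h1
  | succ k ih =>
    have hm' : ∀ j ≤ k, levelForm k (W 0 ^ 2) (fun j => W (j + 1)) j (lastHalf x) ≤ m :=
      fun j hj => hm (j + 1) (by omega)
    have h2 := ih h.tail hδ hm' <| by
      rw [dotProduct_cycleLaplacian_sub, abs_neg]
      have h0 := hm' 0 (by omega)
      rw [levelForm_zero] at h0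
      refine (h.tail.head_approx k _ _).trans ?_
      nlinarith
    rw [← sub_add_sub_cancel _ (cycleLaplacian (k + 1) (W 0)), Matrix.add_mulVec, dotProduct_add,
      cycleLaplacian_sub_approxLU_succ, dotProduct_blocks_last]
    refine (abs_add_le _ _).trans ((add_le_add h1 h2).trans_eq ?_)
    push_cast
    ring

/-! ### Test vectors by back substitution -/

/-- Multiplying on the left by `(yᵀ(I ⊗ W 0), yᵀ)` performs the block elimination, which kills the
first block column. -/
theorem glue_dotProduct_approxLU (W : ℕ → Matrix V V ℝ) (y : Layer k × V → ℝ)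
    (x : Layer (k + 1) × V → ℝ) :
    glue (((1 : Matrix (Layer k) (Layer k) ℝ) ⊗ₖ W 0)ᵀ *ᵥ y) y ⬝ᵥ
      (approxLU W (k + 1) (k + 1) *ᵥ x) =
      y ⬝ᵥ (approxLU (fun j => W (j + 1)) k k *ᵥ lastHalf x) := by
  have e : ∀ z, (((1 : Matrix (Layer k) (Layer k) ℝ) ⊗ₖ W 0)ᵀ *ᵥ y) ⬝ᵥ z =
      y ⬝ᵥ (((1 : Matrix (Layer k) (Layer k) ℝ) ⊗ₖ W 0) *ᵥ z) := fun z => by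
    rw [Matrix.mulVec_transpose, ← Matrix.dotProduct_mulVec]
  rw [approxLU_succ, dotProduct_layer_succ, firstHalf_glue, lastHalf_glue,
    firstHalf_blocks_mulVec, lastHalf_blocks_mulVec, e, ← dotProduct_add]
  congr 1
  simp only [Matrix.mulVec_add, Matrix.one_mulVec, Matrix.neg_mulVec, Matrix.mulVec_neg,
    Matrix.add_mulVec, Matrix.mulVec_mulVec, one_kronecker_mul_cycleMatrix_kronecker, pow_two]
  abel

/-- When the top level attains the maximum, the vector tests itself. -/
theorem IsChain.test_vector_zero {A : Matrix V V ℝ} {W : ℕ → Matrix V V ℝ} {δ₀ δ : ℝ}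
    (h : IsChain k A W δ₀ δ) (hδ₀ : 0 ≤ δ₀) (hδ : 0 ≤ δ) (hδ' : δ ≤ 1) {m : ℝ}
    {x : Layer k × V → ℝ} (hx : levelForm k A W 0 x = m)
    (hm : ∀ j ≤ k, levelForm k A W j x ≤ m) (hm0 : 0 ≤ m) :
    (1 - (δ₀ + k * δ)) * m ≤ x ⬝ᵥ (approxLU W k k *ᵥ x) ∧
      (1 - δ₀) * (1 - δ) ^ k * lapForm k A x ≤ m ∧
      (1 - δ₀) * (1 - δ) ^ k * energy k A W x ≤ (k + 1) * m := by
  have hc : (1 - δ₀) * (1 - δ) ^ k ≤ 1 :=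
    mul_le_one₀ (by linarith) (pow_nonneg (by linarith) _)
      (pow_le_one₀ (by linarith) (by linarith))
  rw [levelForm_zero] at hx
  refine ⟨?_, ?_, ?_⟩
  · have h1 := (abs_le.1 (h.abs_error_self_le hδ₀ hδ hm)).2
    rw [Matrix.sub_mulVec, dotProduct_sub] at h1
    change lapForm _ A x - _ ≤ _ at h1
    linarith
  · rw [hx]
    exact mul_le_of_le_one_left hm0 hc
  · exact (mul_le_of_le_one_left (h.energy_nonneg x) hc).trans (energy_le_of_levelForm_le hm)

/-- A test vector detecting the largest level form. -/
theorem IsChain.exists_test_vector {A : Matrix V V ℝ} {W : ℕ → Matrix V V ℝ} {δ₀ δ : ℝ}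
    (h : IsChain k A W δ₀ δ) (hδ₀ : 0 ≤ δ₀) (hδ : 0 ≤ δ) (hδ' : δ ≤ 1) {m : ℝ}
    {x : Layer k × V → ℝ} {i : ℕ} (hi : i ≤ k) (hx : levelForm k A W i x = m)
    (hm : ∀ j ≤ k, levelForm k A W j x ≤ m) (hm0 : 0 ≤ m) :
    ∃ y, (1 - (δ₀ + k * δ)) * m ≤ y ⬝ᵥ (approxLU W k k *ᵥ x) ∧
      (1 - δ₀) * (1 - δ) ^ k * lapForm k A y ≤ m ∧
      (1 - δ₀) * (1 - δ) ^ k * energy k A W y ≤ (k + 1) * m := by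
  induction k generalizing A W δ₀ i with
  | zero =>
    obtain rfl : i = 0 := by omega
    exact ⟨x, h.test_vector_zero hδ₀ hδ hδ' hx hm hm0⟩
  | succ k ih =>
    rcases i with _ | i
    · exact ⟨x, h.test_vector_zero hδ₀ hδ hδ' hx hm hm0⟩
    obtain ⟨y, h1, h2, h3⟩ := ih h.tail hδ (by omega) hx fun j hj => hm (j + 1) (by omega)
    have hp : 0 ≤ (1 - δ) ^ (k + 1) := pow_nonneg (by linarith) _
    rw [← pow_succ'] at h2 h3
    obtain ⟨z, hz⟩ : ∃ z, z = glue (((1 : Matrix (Layer k) (Layer k) ℝ) ⊗ₖ W 0)ᵀ *ᵥ y) y :=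
      ⟨_, rfl⟩
    -- Extension preserves the form for `W 0`; passing from `W 0` to `A` costs the factor `1 - δ₀`.
    -- The energy of `z` gains just this one new term.
    have hQ : (1 - δ₀) * (1 - δ) ^ (k + 1) * lapForm (k + 1) A z ≤ m := by
      have h4 := (abs_le.1 (h.head_approx.abs_lapForm_sub_le z)).1
      have h5 : lapForm (k + 1) (W 0) z = lapForm k (W 0 ^ 2) y := hz ▸ lapForm_glue _ _
      have h6 : (1 - δ₀) * lapForm (k + 1) A z ≤ lapForm k (W 0 ^ 2) y := by linarith
      linarith [mul_le_mul_of_nonneg_left h6 hp]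
    refine ⟨z, ?_, hQ, ?_⟩
    · rw [hz, glue_dotProduct_approxLU]
      refine le_trans (mul_le_mul_of_nonneg_right ?_ hm0) h1
      push_cast
      linarith
    · have h7 : lastHalf z = y := by rw [hz, lastHalf_glue]
      have h8 : 0 ≤ (1 - δ) ^ (k + 1) * energy k (W 0 ^ 2) (fun j => W (j + 1)) y :=
        mul_nonneg hp (h.tail.energy_nonneg y)
      rw [energy_succ, h7]
      push_cast
      linarith [mul_nonneg hδ₀ h8]

/-! ### The main estimate -/

theorem IsChain.sq_error_le {A : Matrix V V ℝ} {W : ℕ → Matrix V V ℝ} {δ₀ δ : ℝ}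
    (h : IsChain k A W δ₀ δ) (hδ : δ₀ ≤ δ) (x y : Layer k × V → ℝ) :
    (x ⬝ᵥ ((cycleLaplacian k A - approxLU W k k) *ᵥ y)) ^ 2 ≤
      δ ^ 2 * (energy k A W x * energy k A W y) := by
  -- Scaling `x` by `t` makes the additive bound a nonnegative quadratic in `t`; its discriminant
  -- gives the product bound.
  have key : ∀ t : ℝ, 0 ≤ δ / 2 * energy k A W x * (t * t) +
      (-(x ⬝ᵥ ((cycleLaplacian k A - approxLU W k k) *ᵥ y))) * t +
      δ / 2 * energy k A W y := fun t => by
    have h1 := (abs_le.1 (h.abs_error_le hδ (t • x) y)).2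
    rw [smul_dotProduct, energy_smul, smul_eq_mul] at h1
    linarith
  have := discrim_le_zero key
  rw [discrim] at this
  linarith

theorem exists_isMax_levelForm (A : Matrix V V ℝ) (W : ℕ → Matrix V V ℝ) (x : Layer k × V → ℝ) :
    ∃ i ≤ k, ∀ j ≤ k, levelForm k A W j x ≤ levelForm k A W i x := by
  obtain ⟨i, hi, h⟩ := Finset.exists_max_image (Finset.range (k + 1))
    (fun i => levelForm k A W i x) ⟨0, by simp⟩
  exact ⟨i, by simpa [Nat.lt_succ_iff] using hi,
    fun j hj => h j (by simpa [Nat.lt_succ_iff] using hj)⟩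

/-- If `L̃ v = (L̃ - L) x`, then the energy of `v` is small compared with that of `x`. -/
theorem IsChain.energy_le_of_mulVec_eq {W : ℕ → Matrix V V ℝ} {ε : ℝ} (hk : 0 < k)
    (hε : 0 < ε) (hε' : ε ≤ 1 / 2) (h : IsChain k (W 0) W 0 (ε / k)) {x v : Layer k × V → ℝ}
    (hv : approxLU W k k *ᵥ v = (approxLU W k k - cycleLaplacian k (W 0)) *ᵥ x) :
    energy k (W 0) W v ≤ 32 * ε ^ 2 * energy k (W 0) W x := by
  have hk' : (1 : ℝ) ≤ k := by exact_mod_cast hk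
  obtain ⟨δ, hδ⟩ : ∃ δ, δ = ε / k := ⟨_, rfl⟩
  have hkδ : k * δ = ε := by rw [hδ]; field_simp
  rw [← hδ] at h
  have hδ0 : 0 ≤ δ := by rw [hδ]; positivity
  have hδ1 : δ ≤ 1 / 2 := by nlinarith
  obtain ⟨i, hi, hmax⟩ := exists_isMax_levelForm (W 0) W v
  obtain ⟨m, hm⟩ : ∃ m, levelForm k (W 0) W i v = m := ⟨_, rfl⟩
  rw [hm] at hmax
  have hm0 : 0 ≤ m := by
    refine le_trans ?_ (hmax 0 (by omega))
    rw [levelForm_zero]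
    exact lapForm_nonneg h.head_contraction v
  obtain ⟨y, h1, -, h2⟩ := h.exists_test_vector le_rfl hδ0 (by linarith) hi hm hmax hm0
  rw [zero_add, hkδ] at h1
  have hEv := energy_le_of_levelForm_le hmax
  have hEx := h.energy_nonneg x
  have hEy : energy k (W 0) W y ≤ 2 * (k + 1) * m := by
    -- Bernoulli: `(1 - δ) ^ k ≥ 1 - kδ = 1 - ε`.
    have h3 : 1 / 2 ≤ (1 - δ) ^ k := by
      have := one_add_mul_le_pow (a := -δ) (by linarith) k
      rw [← sub_eq_add_neg] at this
      linarith
    have h4 := mul_le_mul_of_nonneg_right h3 (h.energy_nonneg y)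
    rw [sub_zero, one_mul] at h2
    linarith
  have h5 := h.sq_error_le hδ0 y x
  rw [← neg_sub, Matrix.neg_mulVec, ← hv, dotProduct_neg, neg_sq] at h5
  have h6 : (m / 2) ^ 2 ≤ (y ⬝ᵥ (approxLU W k k *ᵥ v)) ^ 2 := by
    refine pow_le_pow_left₀ (by linarith) (le_trans ?_ h1) 2
    nlinarith
  -- Both sides of `(m/2)² ≤ δ² E(y) E(x) ≤ 2(k+1) m δ² E(x)` contain `m`; cancel it when it is
  -- nonzero.
  have h7 : m ≤ 8 * (k + 1) * δ ^ 2 * energy k (W 0) W x := by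
    rcases hm0.eq_or_lt with h0 | h0
    · rw [← h0]; positivity
    · have h8 : energy k (W 0) W y * energy k (W 0) W x ≤
          2 * (k + 1) * m * energy k (W 0) W x := mul_le_mul_of_nonneg_right hEy hEx
      have h9 := mul_le_mul_of_nonneg_left h8 (sq_nonneg δ)
      refine le_of_mul_le_mul_left ?_ h0
      linarith
  calc energy k (W 0) W v ≤ (k + 1) * (8 * (k + 1) * δ ^ 2 * energy k (W 0) W x) :=
        hEv.trans (mul_le_mul_of_nonneg_left h7 (by positivity))
    _ = 8 * (k + 1) ^ 2 * (δ ^ 2 * energy k (W 0) W x) := by ring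
    _ ≤ 8 * (2 * k) ^ 2 * (δ ^ 2 * energy k (W 0) W x) := by
        refine mul_le_mul_of_nonneg_right ?_ (mul_nonneg (sq_nonneg δ) hEx)
        gcongr
        linarith
    _ = 32 * (k * δ) ^ 2 * energy k (W 0) W x := by ring
    _ = 32 * ε ^ 2 * energy k (W 0) W x := by rw [hkδ]

/-! ### Kernels, ranges and the pseudo-inverse -/

/-- A square matrix and its transpose have equal rank, so an inclusion of kernels is an equality. -/
theorem ker_transpose_eq_of_ker_le {ι : Type*} [Fintype ι] {M : Matrix ι ι ℝ}
    (h : ∀ v, M *ᵥ v = 0 → Mᵀ *ᵥ v = 0) (v : ι → ℝ) (hv : Mᵀ *ᵥ v = 0) : M *ᵥ v = 0 := by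
  classical
  have hle : LinearMap.ker M.mulVecLin ≤ LinearMap.ker Mᵀ.mulVecLin := h
  have h1 := LinearMap.finrank_range_add_finrank_ker M.mulVecLin
  have h2 := LinearMap.finrank_range_add_finrank_ker Mᵀ.mulVecLin
  have h3 : Module.finrank ℝ (LinearMap.range M.mulVecLin) =
      Module.finrank ℝ (LinearMap.range Mᵀ.mulVecLin) := (Matrix.rank_transpose M).symm
  have h4 := Submodule.eq_of_le_of_finrank_eq hle (by omega)
  exact h4.ge hv

/-- The hypothesis says that the range of `D` lies in that of `M`, and `M * pinv M` is the
orthogonal projection onto the latter. -/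
theorem mul_pinv_mul_of_ker_transpose {ι : Type*} [Fintype ι] {M D : Matrix ι ι ℝ}
    (h : ∀ v, Mᵀ *ᵥ v = 0 → Dᵀ *ᵥ v = 0) : M * pinv M * D = D := by
  classical
  have hP := isMoorePenrose_pinv M
  have h1 : Mᵀ * (1 - M * pinv M) = 0 := by
    rw [← hP.symm_left, ← Matrix.transpose_one, ← Matrix.transpose_sub, ← Matrix.transpose_mul,
      Matrix.sub_mul, hP.mul_mul_left, Matrix.one_mul, sub_self, Matrix.transpose_zero]
  have h2 : Dᵀ * (1 - M * pinv M) = 0 := by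
    refine Matrix.ext_of_mulVec_single fun i => ?_
    rw [← Matrix.mulVec_mulVec, Matrix.zero_mulVec]
    apply h
    rw [Matrix.mulVec_mulVec, h1, Matrix.zero_mulVec]
  have h3 := congrArg Matrix.transpose h2
  rw [Matrix.transpose_mul, Matrix.transpose_transpose, Matrix.transpose_sub,
    Matrix.transpose_one, hP.symm_left, Matrix.transpose_zero, Matrix.sub_mul, Matrix.one_mul,
    sub_eq_zero] at h3
  exact h3.symm

/-- A vector of zero energy is orthogonal to every error vector by `IsChain.sq_error_le`, and
`‖Lᵀv‖² ≤ 2 vᵀLv` puts it in the kernel of `Lᵀ`. -/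
theorem IsChain.transpose_mulVec_eq_zero {W : ℕ → Matrix V V ℝ} {δ : ℝ} (hδ : 0 ≤ δ)
    (h : IsChain k (W 0) W 0 δ) {v : Layer k × V → ℝ} (hv : energy k (W 0) W v ≤ 0) :
    (approxLU W k k - cycleLaplacian k (W 0))ᵀ *ᵥ v = 0 ∧ (approxLU W k k)ᵀ *ᵥ v = 0 := by
  have hv0 : energy k (W 0) W v = 0 := le_antisymm hv (h.energy_nonneg v)
  have h1 : (approxLU W k k - cycleLaplacian k (W 0))ᵀ *ᵥ v = 0 := by
    refine dotProduct_eq_zero _ fun y => ?_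
    have h2 := h.sq_error_le hδ v y
    rw [hv0, zero_mul, mul_zero] at h2
    rw [Matrix.mulVec_transpose, ← Matrix.dotProduct_mulVec, ← neg_sub, Matrix.neg_mulVec,
      dotProduct_neg, neg_eq_zero]
    exact pow_eq_zero_iff two_ne_zero |>.1 (le_antisymm h2 (sq_nonneg _))
  have h3 : (cycleLaplacian k (W 0))ᵀ *ᵥ v = 0 := by
    have h4 := transpose_cycleLaplacian_mulVec_le h.head_contraction v
    have h5 := h.lapForm_le_energy v
    exact dotProduct_self_eq_zero.1 (le_antisymm (by linarith) (dotProduct_self_nonneg _))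
  refine ⟨h1, ?_⟩
  rw [← sub_add_cancel (approxLU W k k) (cycleLaplacian k (W 0)), Matrix.transpose_add,
    Matrix.add_mulVec, h1, h3, add_zero]

/-- The preconditioned Laplacian is close to the identity in the energy seminorm. -/
theorem IsChain.energy_one_sub_pinv_mul_le {W : ℕ → Matrix V V ℝ} {ε : ℝ} (hk : 0 < k)
    (hε : 0 < ε) (hε' : ε ≤ 1 / 2) (h : IsChain k (W 0) W 0 (ε / k)) (x : Layer k × V → ℝ) :
    energy k (W 0) W ((1 - pinv (approxLU W k k) * cycleLaplacian k (W 0)) *ᵥ x) ≤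
      32 * ε ^ 2 * energy k (W 0) W x := by
  apply h.energy_le_of_mulVec_eq hk hε hε'
  have hδ : 0 ≤ ε / k := by positivity
  set M := approxLU W k k with hM
  set L := cycleLaplacian k (W 0) with hL
  -- The main estimate with `x = 0`.
  have hker : ∀ v, M *ᵥ v = 0 → energy k (W 0) W v ≤ 0 := fun v hv => by
    have h0 : energy k (W 0) W 0 = 0 := by simp [energy]
    have := h.energy_le_of_mulVec_eq hk hε hε' (x := 0) (v := v) (by
      rw [← hM, hv, Matrix.mulVec_zero])
    rwa [h0, mul_zero] at this
  -- Zero energy gives `ker M ≤ ker Mᵀ`, hence equality; so `ker Mᵀ` also has zero energy and is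
  -- killed by `(M - L)ᵀ`.
  have hrange : M * pinv M * (M - L) = M - L :=
    mul_pinv_mul_of_ker_transpose fun v hv => (h.transpose_mulVec_eq_zero hδ (hker v
      (ker_transpose_eq_of_ker_le
        (fun w hw => (h.transpose_mulVec_eq_zero hδ (hker w hw)).2) v hv))).1
  rw [Matrix.mulVec_mulVec]
  congr 1
  rw [Matrix.mul_sub, (isMoorePenrose_pinv M).mul_mul_left, sub_right_inj] at hrange
  rw [Matrix.mul_sub, Matrix.mul_one, ← Matrix.mul_assoc, hrange]

end Forms

/-! ### Regular digraphs -/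

section Regular

variable {V : Type*} [Fintype V] [DecidableEq V]

/-- Jensen in each row, via the nonnegative variance, followed by summation over rows using the
column sums. -/
theorem dotProduct_mulVec_self_le_of_stochastic {A : Matrix V V ℝ} (h0 : ∀ i j, 0 ≤ A i j)
    (hr : ∀ i, ∑ j, A i j = 1) (hc : ∀ j, ∑ i, A i j = 1) (x : V → ℝ) :
    (A *ᵥ x) ⬝ᵥ (A *ᵥ x) ≤ x ⬝ᵥ x := by
  have h1 : ∀ i, (A *ᵥ x) i * (A *ᵥ x) i ≤ ∑ j, A i j * (x j * x j) := fun i => by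
    have h : 0 ≤ ∑ j, A i j * (x j - (A *ᵥ x) i) ^ 2 :=
      Finset.sum_nonneg fun j _ => mul_nonneg (h0 i j) (sq_nonneg _)
    have e : ∀ s, ∑ j, A i j * (x j - s) ^ 2 =
        ∑ j, A i j * (x j * x j) - 2 * s * (A *ᵥ x) i + s ^ 2 * ∑ j, A i j := fun s => by
      simp only [Matrix.mulVec, dotProduct, Finset.mul_sum, ← Finset.sum_sub_distrib,
        ← Finset.sum_add_distrib]
      exact Finset.sum_congr rfl fun j _ => by ring
    rw [e, hr] at h
    linarith
  calc (A *ᵥ x) ⬝ᵥ (A *ᵥ x) ≤ ∑ i, ∑ j, A i j * (x j * x j) :=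
        Finset.sum_le_sum fun i _ => h1 i
    _ = x ⬝ᵥ x := by
        rw [Finset.sum_comm]
        simp only [← Finset.sum_mul, hc, one_mul, dotProduct]

theorem IsStronglyConnectedRegularTransition.isContraction {W : Matrix V V ℝ}
    (h : IsStronglyConnectedRegularTransition W) : IsContraction W := by
  obtain ⟨G, d, hd, hG, -, rfl⟩ := h
  have hd' : (d : ℝ) ≠ 0 := by exact_mod_cast hd.ne'
  have hentry : ∀ i j, G.transitionMatrix i j = (G.edges j i : ℝ) / d := fun i j => by
    have hD : G.degMatrix = Matrix.diagonal fun _ => (d : ℝ) := by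
      rw [Multidigraph.degMatrix]
      congr 1; funext v; rw [(hG v).1]
    have hDi : G.degMatrix⁻¹ = Matrix.diagonal fun _ => (d : ℝ)⁻¹ := by
      rw [hD]
      refine Matrix.inv_eq_right_inv ?_
      rw [Matrix.diagonal_mul_diagonal, ← Matrix.diagonal_one]
      congr 1; funext v; exact mul_inv_cancel₀ hd'
    rw [Multidigraph.transitionMatrix, hDi, Matrix.mul_diagonal, div_eq_mul_inv]
    rfl
  have h0 : ∀ i j, 0 ≤ G.transitionMatrix i j := fun i j => by rw [hentry]; positivity
  have hr : ∀ i, ∑ j, G.transitionMatrix i j = 1 := fun i => by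
    simp only [hentry, ← Finset.sum_div]
    rw [div_eq_one_iff_eq hd']
    exact_mod_cast (hG i).2
  have hc : ∀ j, ∑ i, G.transitionMatrix i j = 1 := fun j => by
    simp only [hentry, ← Finset.sum_div]
    rw [div_eq_one_iff_eq hd']
    exact_mod_cast (hG j).1
  exact ⟨dotProduct_mulVec_self_le_of_stochastic h0 hr hc,
    dotProduct_mulVec_self_le_of_stochastic (fun i j => h0 j i) hc hr⟩

end Regular

end CycleLift
end

/-! ### Conclusion -/

open CycleLift
theorem mainTheorem8 :
    ∃ C : ℝ, 0 < C ∧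
      ∀ (n k : ℕ) (_ : 0 < k) (ε : ℝ) (_ : 0 < ε) (_ : ε < 1 / 2)
        (W : ℕ → Matrix (Fin n) (Fin n) ℝ)
        (_ : ∀ i ≤ k, IsStronglyConnectedRegularTransition (W i))
        (_ : ∀ i < k, UnitCircleApprox (ε / (k : ℝ)) (toComplex (W (i + 1)))
          (toComplex (W i ^ 2))),
        ∃ F : Matrix (Layer k × Fin n) (Layer k × Fin n) ℝ,
          F.PosSemidef ∧
          opSeminorm F (1 - pinv (approxLU W k k) * cycleLaplacian k (W 0)) ≤
            ENNReal.ofReal (C * ((k : ℝ) * ε)) ∧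
          LoewnerLE ((1 / (C * (k : ℝ))) • symmetrization (cycleLaplacian k (W 0))) F ∧
          LoewnerLE F ((C * ((2 : ℝ) ^ (2 * k) * (n : ℝ) ^ 2 * (k : ℝ) ^ 5)) •
            symmetrization (cycleLaplacian k (W 0))) := by
  -- The value `6` works because `32 ≤ 6 ^ 2`; the Loewner bounds need only `1 ≤ 6 k` and `2 ≤ 6`.
  refine ⟨6, by norm_num, fun n k hk ε hε hε' W hW hWW => ?_⟩
  have hk' : (1 : ℝ) ≤ k := by exact_mod_cast hk
  have hδ : 0 ≤ ε / k := by positivity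
  have hδ' : ε / k ≤ 1 / 2 := (div_le_self hε.le hk').trans hε'.le
  have h : IsChain k (W 0) W 0 (ε / k) :=
    ⟨(hW 0 (by omega)).isContraction, fun i hi => (hW i hi).isContraction, LiftApprox.refl _,
      fun i hi => (hWW i hi).liftApprox hδ⟩
  have hpsd : ∀ M : Matrix (Layer k × Fin n) (Layer k × Fin n) ℝ, Mᵀ = M →
      (∀ x, 0 ≤ x ⬝ᵥ (M *ᵥ x)) → M.PosSemidef := fun M hM hx =>
    Matrix.PosSemidef.of_dotProduct_mulVec_nonneg
      (by rw [Matrix.IsHermitian, Matrix.conjTranspose_eq_transpose_of_trivial, hM])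
      (fun x => by simpa using hx x)
  have hform : ∀ (c : ℝ) (x : Layer k × Fin n → ℝ),
      x ⬝ᵥ ((c • symmetrization (cycleLaplacian k (W 0))) *ᵥ x) = c * lapForm k (W 0) x := by
    intro c x
    rw [Matrix.smul_mulVec, dotProduct_smul, dotProduct_symmetrization_mulVec, smul_eq_mul]
    rfl
  refine ⟨energyMatrix k (W 0) W, hpsd _ (transpose_energyMatrix _ _ _) h.energy_nonneg,
    iSup₂_le fun x _ => ENNReal.div_le_of_le_mul ?_, hpsd _ ?_ fun x => ?_, hpsd _ ?_ fun x => ?_⟩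
  · rw [← ENNReal.ofReal_mul (by positivity)]
    refine ENNReal.ofReal_le_ofReal ?_
    have h1 := h.energy_one_sub_pinv_mul_le hk hε hε'.le x
    have h2 : 32 * ε ^ 2 * energy k (W 0) W x ≤ (6 * (k * ε)) ^ 2 * energy k (W 0) W x := by
      refine mul_le_mul_of_nonneg_right ?_ (h.energy_nonneg x)
      nlinarith [mul_le_mul hk' hk' zero_le_one (by positivity), sq_nonneg ε]
    refine (Real.sqrt_le_sqrt (h1.trans h2)).trans_eq ?_
    rw [Real.sqrt_mul (sq_nonneg _), Real.sqrt_sq (by positivity)]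
    rfl
  · rw [Matrix.transpose_sub, Matrix.transpose_smul, transpose_symmetrization,
      transpose_energyMatrix]
  · rw [Matrix.sub_mulVec, dotProduct_sub, hform, sub_nonneg]
    refine le_trans (mul_le_of_le_one_left (lapForm_nonneg h.head_contraction x) ?_)
      (h.lapForm_le_energy x)
    rw [div_le_one (by positivity)]
    linarith
  · rw [Matrix.transpose_sub, Matrix.transpose_smul, transpose_symmetrization,
      transpose_energyMatrix]
  · rw [Matrix.sub_mulVec, dotProduct_sub, hform, sub_nonneg]
    -- The factor `n ^ 2` helps only if `n ≥ 1`; for `n = 0` all vectors are empty.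
    rcases Nat.eq_zero_or_pos n with rfl | hn
    · simp [dotProduct]
    have hn' : (1 : ℝ) ≤ n := by exact_mod_cast hn
    refine (h.energy_le (by norm_num) hδ' x).trans
      (mul_le_mul_of_nonneg_right ?_ (lapForm_nonneg h.head_contraction x))
    have h1 : (1 : ℝ) ≤ (n : ℝ) ^ 2 * (k : ℝ) ^ 5 :=
      one_le_mul_of_one_le_of_one_le (one_le_pow₀ hn') (one_le_pow₀ hk')
    have h2 : (0 : ℝ) < 4 ^ k := by positivity
    rw [pow_mul, show (2 : ℝ) ^ 2 = 4 by norm_num, mul_assoc ((4 : ℝ) ^ k)]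
    nlinarith
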